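/- Let $\mathbb{K}=\mathbb{R}$ or $\mathbb{K}=\mathbb{C}$. For a Banach space $X$ over $\mathbb{K}$ and a finite-dimensional subspace $Y\subset X$, let $$\lambda_{\mathbb{K}}(Y,X)=\inf\{\|P\| : P\colon X\to Y \text{ continuous and linear},\ P|_Y=\mathrm{Id}_Y\}.$$ For a finite-dimensional normed space $Y$ over $\mathbb{K}$, let $\lambda_{\mathbb{K}}(Y)$ be the supremum of $\lambda_{\mathbb{K}}(Y,X)$ over all Banach spaces $X$ over $\mathbb{K}$ that contain $Y$ isometrically as a subspace. For $m\ge 1$ let $$\lambda_{\mathbb{K}}(m)=\sup\{\lambda_{\mathbb{K}}(Y) : \dim Y=m\}$$ (the maximal absolute projection constant), and for $N\ge m$ let $$\mu_{\mathbb{K}}(m,N)=\max\Big\{\frac1N\sum_{i,j=1}^N |(U^*U)_{ij}| : U\in\mathbb{K}^{m\times N},\ UU^*=\mathrm{I}_m\Big\},\qquad \mu_{\mathbb{K}}(m)=\sup\{\mu_{\mathbb{K}}(m,N) : N\ge m\}$$ (the quasimaximal absolute projection constant). Then for every integer $m\ge 1$ the number $\lambda_{\mathbb{K}}(m)$ is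 finite, and $$\lambda_{\mathbb{K}}(m)=\mu_{\mathbb{K}}(m).$$ -/

import Mathlib

open scoped ENNReal Matrix

universe u

/-- The relative projection constant of a subspace `Y` of a normed space `X`: the infimum of the
operator norms of the continuous linear projections of `X` onto `Y`, as an extended nonnegative
real number (it is `∞` if there is no such projection). -/
noncomputable def relProjConst (𝕜 : Type) [RCLike 𝕜] (X : Type u) [NormedAddCommGroup X]
    [NormedSpace 𝕜 X] (Y : Submodule 𝕜 X) : ℝ≥0∞ :=
  ⨅ (P : X →L[𝕜] Y) (_ : ∀ y : Y, P (y : X) = y), ‖P‖ₑ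

/-- The absolute projection constant of a normed space `Y`: the supremum of the relative projection
constants of `Y` in all Banach spaces `X` that contain `Y` isometrically. -/
noncomputable def absProjConst (𝕜 : Type) [RCLike 𝕜] (Y : Type u) [NormedAddCommGroup Y]
    [NormedSpace 𝕜 Y] : ℝ≥0∞ :=
  ⨆ (X : Type u) (_ : NormedAddCommGroup X) (_ : NormedSpace 𝕜 X) (_ : CompleteSpace X)
    (e : Y →ₗᵢ[𝕜] X), relProjConst 𝕜 X (LinearMap.range e.toLinearMap)

/-- The maximal absolute projection constant: the supremum of the absolute projection constants of
all normed spaces over `𝕜` of dimension `m`. -/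
noncomputable def maxAbsProjConst (𝕜 : Type) [RCLike 𝕜] (m : ℕ) : ℝ≥0∞ :=
  ⨆ (Y : Type u) (_ : NormedAddCommGroup Y) (_ : NormedSpace 𝕜 Y) (_ : FiniteDimensional 𝕜 Y)
    (_ : Module.finrank 𝕜 Y = m), absProjConst 𝕜 Y

/-- The quasimaximal relative projection constant: the supremum of `(1 / N) ∑ i, j, |(U* U) i j|`
over all `m × N` matrices `U` over `𝕜` with `U U* = I`. -/
noncomputable def quasimaxRelProjConst (𝕜 : Type) [RCLike 𝕜] (m N : ℕ) : ℝ≥0∞ :=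
  ⨆ (U : Matrix (Fin m) (Fin N) 𝕜) (_ : U * Uᴴ = 1),
    ENNReal.ofReal ((1 / (N : ℝ)) * ∑ i : Fin N, ∑ j : Fin N, ‖(Uᴴ * U) i j‖)

/-- The quasimaximal absolute projection constant: the supremum of the quasimaximal relative
projection constants over all `N ≥ m`. -/
noncomputable def quasimaxAbsProjConst (𝕜 : Type) [RCLike 𝕜] (m : ℕ) : ℝ≥0∞ :=
  ⨆ (N : ℕ) (_ : m ≤ N), quasimaxRelProjConst 𝕜 m N

/-! ### First-order condition for maximizers of a compressed trace -/

section Trace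

variable {𝕜 : Type} [RCLike 𝕜] {m n : Type*} [Fintype n]

/-! Lower bound: for fixed `N`, let `U` maximize `∑ |(Uᴴ U) i j|` and let `S` be the entrywise sign
of `G = Uᴴ U`. Then `U` also maximizes the linearized functional `Re tr (U' S U'ᴴ)`, so its row
space is invariant under `S` (`dotProduct_mulVec_eq_zero_of_trace_max`). Hence every projection `p`
of `ℓ_∞^N` onto the range of `Uᴴ` has `tr (p S) = tr (G S) = ∑ |G i j|`, while `|tr (p S)| ≤ N ‖p‖`.
So this one subspace has relative projection constant at least the maximum
(`sum_norm_le_card_mul_norm_projection`).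

Upper bound: finitely many functionals `f j` separating the points of `Y` embed `Y` in a Euclidean
space, and an orthonormal basis of the image gives vectors with `y = ∑ f j y • v j` and `∑ |f a (v
b)|` controlled by the quasimaximal constant (`exists_reconstruction`). Repeating functionals turns
this average into any weighted average, and a minimax argument turns weighted averages into a bound
for each functional (`exists_uniform_reconstruction`). If the functionals almost norm `Y`, their
Hahn–Banach extensions give a projection of nearly the required norm (`relProjConst_le_quasimax`).
-/

theorem trace_mul_conjTranspose_eq_sum [Fintype m] (S : Matrix n n 𝕜) (U : Matrix m n 𝕜) :
    (U * S * Uᴴ).trace = ∑ k, U k ⬝ᵥ S *ᵥ star (U k) := by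
  simp only [Matrix.trace, Matrix.diag_apply]
  refine Finset.sum_congr rfl fun k _ => ?_
  rw [Matrix.mul_apply_eq_vecMul, Matrix.dotProduct_mulVec]
  rfl

theorem dotProduct_star_eq_star (x y : n → 𝕜) : x ⬝ᵥ star y = star (y ⬝ᵥ star x) := by
  simp [dotProduct, mul_comm]

theorem mul_conjTranspose_updateRow [DecidableEq m] {U : Matrix m n 𝕜} (hU : U * Uᴴ = 1) (k : m)
    {r : n → 𝕜} (hr : r ⬝ᵥ star r = 1) (hUr : ∀ l ≠ k, U l ⬝ᵥ star r = 0) :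
    U.updateRow k r * (U.updateRow k r)ᴴ = 1 := by
  have hrU : ∀ l ≠ k, r ⬝ᵥ star (U l) = 0 := fun l hl => by
    rw [dotProduct_star_eq_star, hUr l hl, star_zero]
  have hUU : ∀ i j, U i ⬝ᵥ star (U j) = (1 : Matrix m m 𝕜) i j := fun i j => by
    rw [← hU]; rfl
  ext i j
  change U.updateRow k r i ⬝ᵥ star (U.updateRow k r j) = _
  by_cases hi : i = k <;> by_cases hj : j = k
  · subst hi; subst hj; simp [hr]
  · subst hi; simp [Matrix.updateRow_ne hj, hrU j hj, Matrix.one_apply_ne' hj]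
  · subst hj; simp [Matrix.updateRow_ne hi, hUr i hi, Matrix.one_apply_ne hi]
  · rw [Matrix.updateRow_ne hi, Matrix.updateRow_ne hj, hUU]

theorem re_quadForm_add {S : Matrix n n 𝕜} (hS : Sᴴ = S) (x w : n → 𝕜) :
    RCLike.re ((x + w) ⬝ᵥ S *ᵥ star (x + w)) =
      RCLike.re (x ⬝ᵥ S *ᵥ star x) + 2 * RCLike.re (w ⬝ᵥ S *ᵥ star x)
        + RCLike.re (w ⬝ᵥ S *ᵥ star w) := by
  have h : x ⬝ᵥ S *ᵥ star w = star (w ⬝ᵥ S *ᵥ star x) := by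
    rw [Matrix.dotProduct_mulVec, dotProduct_star_eq_star, Matrix.star_vecMul, hS]
  have h' : RCLike.re (x ⬝ᵥ S *ᵥ star w) = RCLike.re (w ⬝ᵥ S *ᵥ star x) := by
    rw [h]; exact RCLike.conj_re _
  rw [star_add, Matrix.mulVec_add, add_dotProduct, dotProduct_add, dotProduct_add]
  simp only [map_add, h']
  ring

variable [Fintype m] [DecidableEq m]

/-- Row `k` is replaced by the normalization of `U k + w`, of squared length `1 + ∑ ‖w j‖ ^ 2`.
Since `w` is orthogonal to all rows, the system stays orthonormal and maximality applies; clearing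
the normalization gives the inequality. -/
theorem quadForm_perturb_le {S : Matrix n n 𝕜} (hS : Sᴴ = S) {U : Matrix m n 𝕜}
    (hU : U * Uᴴ = 1)
    (hmax : ∀ U' : Matrix m n 𝕜, U' * U'ᴴ = 1 →
      RCLike.re (U' * S * U'ᴴ).trace ≤ RCLike.re (U * S * Uᴴ).trace)
    {w : n → 𝕜} (hw : U *ᵥ star w = 0) (k : m) :
    2 * RCLike.re (w ⬝ᵥ S *ᵥ star (U k)) + RCLike.re (w ⬝ᵥ S *ᵥ star w) ≤
      RCLike.re (U k ⬝ᵥ S *ᵥ star (U k)) * ∑ j, ‖w j‖ ^ 2 := by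
  set s : ℝ := ∑ j, ‖w j‖ ^ 2 with hs
  have hs0 : 0 ≤ s := Finset.sum_nonneg fun _ _ => by positivity
  have hUU : ∀ i j, U i ⬝ᵥ star (U j) = (1 : Matrix m m 𝕜) i j := fun i j => by
    rw [← hU]; rfl
  have hUw : ∀ l, U l ⬝ᵥ star w = 0 := fun l => congrFun hw l
  have hwU : w ⬝ᵥ star (U k) = 0 := by
    rw [dotProduct_star_eq_star, hUw k, star_zero]
  have hww : w ⬝ᵥ star w = (s : 𝕜) := by
    simp [dotProduct, hs, RCLike.mul_conj]
  set c : ℝ := (Real.sqrt (1 + s))⁻¹ with hc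
  have hc2 : c * c * (1 + s) = 1 := by
    have : Real.sqrt (1 + s) * Real.sqrt (1 + s) = 1 + s := Real.mul_self_sqrt (by linarith)
    have h0 : Real.sqrt (1 + s) ≠ 0 := by positivity
    rw [hc, ← mul_inv, this, inv_mul_cancel₀ (by linarith)]
  set r : n → 𝕜 := (c : 𝕜) • (U k + w) with hr
  have hstar : star r = (c : 𝕜) • star (U k + w) := by
    rw [hr, star_smul]; simp
  have h1 : r ⬝ᵥ star r = 1 := by
    rw [hstar, hr, smul_dotProduct, dotProduct_smul, star_add, add_dotProduct, dotProduct_add,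
      dotProduct_add, hUU, hUw, hwU, hww]
    simp only [Matrix.one_apply_eq, smul_eq_mul]
    have := congrArg (fun x : ℝ => (x : 𝕜)) hc2
    push_cast at this
    linear_combination this
  have h2 : ∀ l ≠ k, U l ⬝ᵥ star r = 0 := fun l hl => by
    rw [hstar, dotProduct_smul, star_add, dotProduct_add, hUU, hUw, Matrix.one_apply_ne hl]
    simp
  have h3 := hmax _ (mul_conjTranspose_updateRow hU k h1 h2)
  rw [trace_mul_conjTranspose_eq_sum, trace_mul_conjTranspose_eq_sum,
    ← Finset.add_sum_erase _ _ (Finset.mem_univ k),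
    ← Finset.add_sum_erase _ (fun l => U l ⬝ᵥ S *ᵥ star (U l)) (Finset.mem_univ k),
    Matrix.updateRow_self] at h3
  have h4 : ∑ l ∈ Finset.univ.erase k,
      U.updateRow k r l ⬝ᵥ S *ᵥ star (U.updateRow k r l) =
      ∑ l ∈ Finset.univ.erase k, U l ⬝ᵥ S *ᵥ star (U l) :=
    Finset.sum_congr rfl fun l hl => by rw [Matrix.updateRow_ne (Finset.ne_of_mem_erase hl)]
  rw [h4, map_add, map_add, add_le_add_iff_right, hstar, hr, Matrix.mulVec_smul, smul_dotProduct,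
    dotProduct_smul, smul_eq_mul, smul_eq_mul, RCLike.re_ofReal_mul, RCLike.re_ofReal_mul,
    re_quadForm_add hS] at h3
  have h5 := mul_le_mul_of_nonneg_right h3 (by linarith : 0 ≤ 1 + s)
  set a := RCLike.re (U k ⬝ᵥ S *ᵥ star (U k))
  set b := RCLike.re (w ⬝ᵥ S *ᵥ star (U k))
  set d := RCLike.re (w ⬝ᵥ S *ᵥ star w)
  have h6 : c * (c * (a + 2 * b + d)) * (1 + s) = a + 2 * b + d := by
    linear_combination (a + 2 * b + d) * hc2
  rw [h6] at h5
  linarith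

/-- The row space of an orthonormal system that maximizes the trace of the compression of a
Hermitian matrix is invariant under that matrix. -/
theorem dotProduct_mulVec_eq_zero_of_trace_max {S : Matrix n n 𝕜} (hS : Sᴴ = S)
    {U : Matrix m n 𝕜} (hU : U * Uᴴ = 1)
    (hmax : ∀ U' : Matrix m n 𝕜, U' * U'ᴴ = 1 →
      RCLike.re (U' * S * U'ᴴ).trace ≤ RCLike.re (U * S * Uᴴ).trace)
    {z : n → 𝕜} (hz : U *ᵥ star z = 0) (k : m) : z ⬝ᵥ S *ᵥ star (U k) = 0 := by
  set b := z ⬝ᵥ S *ᵥ star (U k) with hb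
  by_contra hne
  have hβ : 0 < ‖b‖ ^ 2 := by positivity
  set K := RCLike.re (z ⬝ᵥ S *ᵥ star z) - RCLike.re (U k ⬝ᵥ S *ᵥ star (U k)) * ∑ j, ‖z j‖ ^ 2
    with hK
  -- The perturbation `w = ε b̄ z` makes the first-order term real and equal to `2 ε ‖b‖ ^ 2`; a
  -- small `ε > 0` then contradicts `b ≠ 0`.
  have key : ∀ ε : ℝ, 2 * ε * ‖b‖ ^ 2 + ε ^ 2 * ‖b‖ ^ 2 * K ≤ 0 := fun ε => by
    have h0 : U *ᵥ star (((ε : 𝕜) * star b) • z) = 0 := by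
      rw [star_smul, Matrix.mulVec_smul, hz, smul_zero]
    have h := quadForm_perturb_le hS hU hmax h0 k
    have e1 : (((ε : 𝕜) * star b) • z) ⬝ᵥ S *ᵥ star (U k) = ((ε * ‖b‖ ^ 2 : ℝ) : 𝕜) := by
      rw [smul_dotProduct, ← hb, smul_eq_mul, mul_assoc]
      push_cast
      rw [← RCLike.conj_mul]; rfl
    have e2 : (((ε : 𝕜) * star b) • z) ⬝ᵥ S *ᵥ star (((ε : 𝕜) * star b) • z) =
        ((ε ^ 2 * ‖b‖ ^ 2 : ℝ) : 𝕜) * (z ⬝ᵥ S *ᵥ star z) := by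
      rw [star_smul, Matrix.mulVec_smul, smul_dotProduct, dotProduct_smul, smul_eq_mul,
        smul_eq_mul, ← mul_assoc]
      congr 1
      push_cast
      rw [← RCLike.conj_mul, star_mul, star_star]
      simp only [RCLike.star_def, RCLike.conj_ofReal]
      ring
    have e3 : ∑ j, ‖(((ε : 𝕜) * star b) • z) j‖ ^ 2 = ε ^ 2 * ‖b‖ ^ 2 * ∑ j, ‖z j‖ ^ 2 := by
      rw [Finset.mul_sum]
      refine Finset.sum_congr rfl fun j _ => ?_
      simp [mul_pow]
    rw [e1, e2, e3, RCLike.ofReal_re, RCLike.re_ofReal_mul] at h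
    rw [hK]; linarith
  have h1 := key (|K| + 1)⁻¹
  have h2 : 0 < |K| + 1 := by positivity
  have h3 : -|K| ≤ K := neg_abs_le K
  have h4 : 2 * (|K| + 1)⁻¹ * ‖b‖ ^ 2 + (|K| + 1)⁻¹ ^ 2 * ‖b‖ ^ 2 * K =
      ‖b‖ ^ 2 * (2 * (|K| + 1) + K) * ((|K| + 1)⁻¹) ^ 2 := by
    field_simp
  rw [h4] at h1
  have h5 : 0 < ‖b‖ ^ 2 * (2 * (|K| + 1) + K) * ((|K| + 1)⁻¹) ^ 2 := by
    have : 0 < 2 * (|K| + 1) + K := by linarith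
    positivity
  linarith

theorem trace_mul_eq_zero_of_trace_max {S : Matrix n n 𝕜} (hS : Sᴴ = S)
    {U : Matrix m n 𝕜} (hU : U * Uᴴ = 1)
    (hmax : ∀ U' : Matrix m n 𝕜, U' * U'ᴴ = 1 →
      RCLike.re (U' * S * U'ᴴ).trace ≤ RCLike.re (U * S * Uᴴ).trace)
    {V : Matrix m n 𝕜} (hV : V * Uᴴ = 0) : (V * S * Uᴴ).trace = 0 := by
  refine Finset.sum_eq_zero fun k _ => ?_
  rw [Matrix.diag_apply, Matrix.mul_apply_eq_vecMul]
  have h0 : U *ᵥ star (V k) = 0 := by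
    have := congrArg Matrix.conjTranspose hV
    rw [Matrix.conjTranspose_mul, Matrix.conjTranspose_conjTranspose,
      Matrix.conjTranspose_zero] at this
    ext l
    exact congrFun (congrFun this l) k
  have := dotProduct_mulVec_eq_zero_of_trace_max hS hU hmax h0 k
  rw [Matrix.dotProduct_mulVec] at this
  exact this

end Trace

/-! ### Coisometries: the trivial bound and existence of maximizers -/

section Coisometry

variable {𝕜 : Type} [RCLike 𝕜] {m n : Type*} [Fintype n] [DecidableEq m]

theorem sum_norm_sq_row_of_mul_conjTranspose {U : Matrix m n 𝕜} (hU : U * Uᴴ = 1) (k : m) :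
    ∑ j, ‖U k j‖ ^ 2 = 1 := by
  have h := congrFun (congrFun hU k) k
  rw [Matrix.mul_apply, Matrix.one_apply_eq] at h
  have h2 : ∑ j, U k j * Uᴴ j k = ((∑ j, ‖U k j‖ ^ 2 : ℝ) : 𝕜) := by
    push_cast
    refine Finset.sum_congr rfl fun j _ => ?_
    rw [Matrix.conjTranspose_apply, RCLike.star_def, RCLike.mul_conj]
  rw [h2] at h
  exact_mod_cast h

/-- The arithmetic-geometric mean inequality, applied termwise. This crude bound is the source of
finiteness. -/
theorem sum_norm_conjTranspose_mul_le [Fintype m] {U : Matrix m n 𝕜} (hU : U * Uᴴ = 1) :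
    ∑ i, ∑ j, ‖(Uᴴ * U) i j‖ ≤ Fintype.card n * Fintype.card m := by
  have h1 : ∀ i j, ‖(Uᴴ * U) i j‖ ≤ ∑ k, (‖U k i‖ ^ 2 + ‖U k j‖ ^ 2) / 2 := fun i j => by
    rw [Matrix.mul_apply]
    refine (norm_sum_le _ _).trans (Finset.sum_le_sum fun k _ => ?_)
    rw [norm_mul, Matrix.conjTranspose_apply, norm_star]
    nlinarith [sq_nonneg (‖U k i‖ - ‖U k j‖)]
  have h2 : ∑ i, ∑ k, ‖U k i‖ ^ 2 = (Fintype.card m : ℝ) := by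
    rw [Finset.sum_comm]
    simp [sum_norm_sq_row_of_mul_conjTranspose hU]
  calc ∑ i, ∑ j, ‖(Uᴴ * U) i j‖
      ≤ ∑ i, ∑ j, ∑ k, (‖U k i‖ ^ 2 + ‖U k j‖ ^ 2) / 2 :=
        Finset.sum_le_sum fun i _ => Finset.sum_le_sum fun j _ => h1 i j
    _ = Fintype.card n * Fintype.card m := by
        simp only [← Finset.sum_div, Finset.sum_add_distrib, Finset.sum_const, h2,
          Finset.card_univ, nsmul_eq_mul, ← Finset.mul_sum]
        ring

theorem isCompact_setOf_mul_conjTranspose_eq_one :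
    IsCompact {U : Matrix m n 𝕜 | U * Uᴴ = 1} := by
  have hc : IsCompact (Set.univ.pi fun _ : m => Set.univ.pi fun _ : n =>
      Metric.closedBall (0 : 𝕜) 1) :=
    isCompact_univ_pi fun _ => isCompact_univ_pi fun _ => isCompact_closedBall _ _
  refine IsCompact.of_isClosed_subset (X := m → n → 𝕜) hc ?_ ?_
  · have hc' : Continuous fun U : Matrix m n 𝕜 => U * Uᴴ :=
      continuous_id.matrix_mul continuous_id.matrix_conjTranspose
    exact isClosed_eq hc' continuous_const
  · intro U hU k _ j _
    rw [mem_closedBall_zero_iff]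
    have h := sum_norm_sq_row_of_mul_conjTranspose (U := U) hU k
    have h1 : ‖U k j‖ ^ 2 ≤ 1 := by
      rw [← h]
      exact Finset.single_le_sum (f := fun j => ‖U k j‖ ^ 2) (fun _ _ => by positivity)
        (Finset.mem_univ j)
    exact (sq_le_one_iff₀ (norm_nonneg _)).1 h1

theorem exists_isMaxOn_sum_norm [Fintype m] (U₀ : Matrix m n 𝕜) (hU₀ : U₀ * U₀ᴴ = 1) :
    ∃ U : Matrix m n 𝕜, U * Uᴴ = 1 ∧ ∀ U' : Matrix m n 𝕜, U' * U'ᴴ = 1 →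
      ∑ i, ∑ j, ‖(U'ᴴ * U') i j‖ ≤ ∑ i, ∑ j, ‖(Uᴴ * U) i j‖ := by
  have hcont : Continuous fun U : Matrix m n 𝕜 => ∑ i, ∑ j, ‖(Uᴴ * U) i j‖ := by
    refine continuous_finsetSum _ fun i _ => continuous_finsetSum _ fun j _ => ?_
    exact ((continuous_id.matrix_conjTranspose.matrix_mul continuous_id).matrix_elem i j).norm
  obtain ⟨U, hU, hmax⟩ := isCompact_setOf_mul_conjTranspose_eq_one.exists_isMaxOn
    ⟨U₀, hU₀⟩ hcont.continuousOn
  exact ⟨U, hU, fun U' hU' => hmax hU'⟩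

end Coisometry

/-! ### Lower bound: the row space of a maximizer inside `ℓ_∞^N` -/

section LowerBound

variable {𝕜 : Type} [RCLike 𝕜] {m : Type*} {n : Type u}

/-- The entrywise sign of a matrix. -/
noncomputable def signMatrix (G : Matrix n n 𝕜) : Matrix n n 𝕜 :=
  fun i j => G i j / (‖G i j‖ : 𝕜)

theorem norm_signMatrix_le (G : Matrix n n 𝕜) (i j : n) : ‖signMatrix G i j‖ ≤ 1 := by
  rw [signMatrix, norm_div, RCLike.norm_ofReal, abs_norm]
  -- Only `≤`: a zero entry has sign `0 / 0 = 0`.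
  exact div_self_le_one _

theorem conjTranspose_signMatrix {G : Matrix n n 𝕜} (hG : Gᴴ = G) :
    (signMatrix G)ᴴ = signMatrix G := by
  ext i j
  have h : star (G j i) = G i j := congrFun (congrFun hG i) j
  rw [Matrix.conjTranspose_apply, signMatrix, signMatrix, ← h, norm_star, star_div₀]
  congr 1
  exact RCLike.conj_ofReal _

variable [Fintype n]

theorem trace_mul_signMatrix {G : Matrix n n 𝕜} (hG : Gᴴ = G) :
    (G * signMatrix G).trace = ((∑ i, ∑ j, ‖G i j‖ : ℝ) : 𝕜) := by
  push_cast
  refine Finset.sum_congr rfl fun i _ => ?_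
  rw [Matrix.diag_apply, Matrix.mul_apply]
  refine Finset.sum_congr rfl fun j _ => ?_
  have h : star (G i j) = G j i := congrFun (congrFun hG j) i
  rw [signMatrix, ← h, norm_star, mul_div_assoc', RCLike.star_def, RCLike.mul_conj, sq]
  exact mul_self_div_self _

theorem re_trace_mul_le_sum_norm (G : Matrix n n 𝕜) {S : Matrix n n 𝕜}
    (hS : ∀ i j, ‖S i j‖ ≤ 1) : RCLike.re (G * S).trace ≤ ∑ i, ∑ j, ‖G i j‖ := by
  refine (RCLike.re_le_norm _).trans ?_
  refine (norm_sum_le _ _).trans (Finset.sum_le_sum fun i _ => ?_)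
  rw [Matrix.diag_apply, Matrix.mul_apply]
  refine (norm_sum_le _ _).trans (Finset.sum_le_sum fun j _ => ?_)
  rw [norm_mul]
  exact mul_le_of_le_one_right (norm_nonneg _) (hS _ _)

/-- The `j`-th diagonal entry is the `j`-th coordinate of `T` applied to column `j` of `S`, a vector
in the unit ball of the sup norm. -/
theorem norm_trace_toMatrix'_mul_le [DecidableEq n] (T : (n → 𝕜) →L[𝕜] (n → 𝕜))
    {S : Matrix n n 𝕜} (hS : ∀ i j, ‖S i j‖ ≤ 1) :
    ‖(LinearMap.toMatrix' T.toLinearMap * S).trace‖ ≤ Fintype.card n * ‖T‖ := by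
  have h : ∀ j, (LinearMap.toMatrix' T.toLinearMap * S) j j = T (fun i => S i j) j := fun j => by
    rw [show T (fun i => S i j) = LinearMap.toMatrix' T.toLinearMap *ᵥ (fun i => S i j) from
      (LinearMap.toMatrix'_mulVec _ _).symm]
    rfl
  have h2 : ∀ j, ‖(LinearMap.toMatrix' T.toLinearMap * S) j j‖ ≤ ‖T‖ := fun j => by
    rw [h]
    refine (norm_le_pi_norm _ j).trans ((T.le_opNorm _).trans ?_)
    refine mul_le_of_le_one_right (norm_nonneg _) ?_
    exact (pi_norm_le_iff_of_nonneg zero_le_one).2 fun i => hS i j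
  calc _ ≤ ∑ j, ‖(LinearMap.toMatrix' T.toLinearMap * S) j j‖ := norm_sum_le _ _
    _ ≤ ∑ _j : n, ‖T‖ := Finset.sum_le_sum fun j _ => h2 j
    _ = _ := by simp

variable [Fintype m] [DecidableEq m]

theorem sum_norm_le_card_mul_norm_projection {U : Matrix m n 𝕜}
    (hU : U * Uᴴ = 1)
    (hmax : ∀ U' : Matrix m n 𝕜, U' * U'ᴴ = 1 →
      ∑ i, ∑ j, ‖(U'ᴴ * U') i j‖ ≤ ∑ i, ∑ j, ‖(Uᴴ * U) i j‖)
    {Y : Submodule 𝕜 (n → 𝕜)} (hY : Y = LinearMap.range Uᴴ.mulVecLin)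
    (P : (n → 𝕜) →L[𝕜] Y) (hP : ∀ y : Y, P (y : n → 𝕜) = y) :
    ∑ i, ∑ j, ‖(Uᴴ * U) i j‖ ≤ Fintype.card n * ‖P‖ := by
  classical
  set G := Uᴴ * U with hG
  have hGH : Gᴴ = G := by simp [hG]
  set S := signMatrix G
  have hS : Sᴴ = S := conjTranspose_signMatrix hGH
  have hcyc : ∀ A B : Matrix m n 𝕜, (A * S * Bᴴ).trace = (Bᴴ * A * S).trace := fun A B => by
    rw [Matrix.trace_mul_comm, Matrix.mul_assoc]
  -- With `S` frozen, the linear functional is dominated by the sum of norms, with equality at `U`.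
  have hmax' : ∀ U' : Matrix m n 𝕜, U' * U'ᴴ = 1 →
      RCLike.re (U' * S * U'ᴴ).trace ≤ RCLike.re (U * S * Uᴴ).trace := fun U' hU' => by
    rw [hcyc, hcyc, ← hG, trace_mul_signMatrix hGH, RCLike.ofReal_re]
    exact (re_trace_mul_le_sum_norm _ (norm_signMatrix_le G)).trans (hmax U' hU')
  set T : (n → 𝕜) →L[𝕜] (n → 𝕜) := Y.subtypeL ∘L P with hT
  have hTle : ‖T‖ ≤ ‖P‖ := by
    refine T.opNorm_le_bound (norm_nonneg P) fun x => ?_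
    exact P.le_opNorm x
  set p := LinearMap.toMatrix' T.toLinearMap with hp
  have hpx : ∀ x, p *ᵥ x = P x := fun x => LinearMap.toMatrix'_mulVec _ _
  have hpU : p * Uᴴ = Uᴴ := by
    refine Matrix.mulVec_injective (funext fun c => ?_)
    have hmem : Uᴴ *ᵥ c ∈ Y := by rw [hY]; exact ⟨c, rfl⟩
    rw [← Matrix.mulVec_mulVec, hpx, hP ⟨_, hmem⟩]
  have hGp : G * p = p := by
    refine Matrix.mulVec_injective (funext fun x => ?_)
    rw [← Matrix.mulVec_mulVec, hpx]
    have hmem : (P x : n → 𝕜) ∈ LinearMap.range Uᴴ.mulVecLin := hY ▸ (P x).2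
    obtain ⟨c, hc⟩ := hmem
    rw [← hc, Matrix.mulVecLin_apply, Matrix.mulVec_mulVec, hG, Matrix.mul_assoc, hU,
      Matrix.mul_one]
  -- Optimality tested on `V = U p - U` gives `tr (p S) = tr (G S)`, because `G p = p`.
  have hV : (U * p - U) * Uᴴ = 0 := by
    rw [Matrix.sub_mul, Matrix.mul_assoc, hpU, sub_self]
  have h0 := trace_mul_eq_zero_of_trace_max hS hU hmax' hV
  rw [hcyc, Matrix.mul_sub, ← Matrix.mul_assoc, ← hG, hGp, Matrix.sub_mul, Matrix.trace_sub,
    trace_mul_signMatrix hGH, sub_eq_zero] at h0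
  have h1 := norm_trace_toMatrix'_mul_le T (norm_signMatrix_le G)
  rw [← hp, h0, RCLike.norm_ofReal] at h1
  calc _ ≤ _ := le_abs_self _
    _ ≤ _ := h1
    _ ≤ _ := by gcongr

theorem finrank_range_conjTranspose {U : Matrix m n 𝕜} (hU : U * Uᴴ = 1) :
    Module.finrank 𝕜 (LinearMap.range Uᴴ.mulVecLin) = Fintype.card m := by
  have hinj : Function.Injective Uᴴ.mulVecLin := fun c d h => by
    have := congrArg (U *ᵥ ·) h
    simpa [Matrix.mulVec_mulVec, hU] using this
  rw [LinearMap.finrank_range_of_inj hinj, Module.finrank_fintype_fun_eq_card]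

theorem ofReal_le_maxAbsProjConst {k : ℕ} (hk : 1 ≤ k) {N : ℕ} (hN : k ≤ N)
    (U : Matrix (Fin k) (Fin N) 𝕜) (hU : U * Uᴴ = 1) :
    ENNReal.ofReal ((1 / (N : ℝ)) * ∑ i, ∑ j, ‖(Uᴴ * U) i j‖) ≤ maxAbsProjConst.{u} 𝕜 k := by
  -- The ambient space `ν → 𝕜` has to live in universe `u`.
  let ν := ULift.{u} (Fin N)
  let U₀ : Matrix (Fin k) ν 𝕜 := U.submatrix id Equiv.ulift
  have hU₀ : U₀ * U₀ᴴ = 1 := by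
    rw [Matrix.conjTranspose_submatrix, Matrix.submatrix_mul_equiv, hU]
    exact Matrix.submatrix_id_id _
  have hsum : ∑ i, ∑ j, ‖(Uᴴ * U) i j‖ = ∑ i, ∑ j, ‖(U₀ᴴ * U₀) i j‖ := by
    refine (Fintype.sum_equiv Equiv.ulift _ _ fun i => ?_).symm
    exact Fintype.sum_equiv Equiv.ulift _ _ fun j => rfl
  obtain ⟨V, hV, hmax⟩ := exists_isMaxOn_sum_norm U₀ hU₀
  let Y : Submodule 𝕜 (ν → 𝕜) := LinearMap.range Vᴴ.mulVecLin
  have hfin : Module.finrank 𝕜 Y = k := by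
    rw [finrank_range_conjTranspose hV, Fintype.card_fin]
  have hN0 : (0 : ℝ) < N := by exact_mod_cast lt_of_lt_of_le hk hN
  have hle : absProjConst 𝕜 Y ≤ maxAbsProjConst.{u} 𝕜 k := by
    unfold maxAbsProjConst
    exact le_iSup_of_le Y <| le_iSup_of_le inferInstance <| le_iSup_of_le inferInstance <|
      le_iSup_of_le inferInstance <| le_iSup_of_le hfin le_rfl
  refine le_trans ?_ hle
  unfold absProjConst
  refine le_iSup_of_le (ν → 𝕜) <| le_iSup_of_le inferInstance <| le_iSup_of_le inferInstance <|
      le_iSup_of_le inferInstance <| le_iSup_of_le Y.subtypeₗᵢ ?_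
  have hrange : LinearMap.range Y.subtypeₗᵢ.toLinearMap = LinearMap.range Vᴴ.mulVecLin :=
    Y.range_subtype
  refine le_iInf fun P => le_iInf fun hP => ?_
  have h := sum_norm_le_card_mul_norm_projection hV hmax hrange P hP
  rw [← ofReal_norm]
  refine ENNReal.ofReal_le_ofReal ?_
  rw [one_div, inv_mul_le_iff₀ hN0, hsum]
  refine (hmax U₀ hU₀).trans (h.trans_eq ?_)
  simp [ν]

end LowerBound

theorem quasimaxAbsProjConst_le_maxAbsProjConst (𝕜 : Type) [RCLike 𝕜] {m : ℕ} (hm : 1 ≤ m) :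
    quasimaxAbsProjConst 𝕜 m ≤ maxAbsProjConst.{u} 𝕜 m :=
  iSup_le fun _ => iSup_le fun hN => iSup_le fun U => iSup_le fun hU =>
    ofReal_le_maxAbsProjConst hm hN U hU

theorem quasimaxAbsProjConst_le (𝕜 : Type) [RCLike 𝕜] {m : ℕ} (hm : 1 ≤ m) :
    quasimaxAbsProjConst 𝕜 m ≤ m := by
  refine iSup_le fun N => iSup_le fun hN => iSup_le fun U => iSup_le fun hU => ?_
  have hN0 : (0 : ℝ) < N := by exact_mod_cast lt_of_lt_of_le hm hN
  rw [← ENNReal.ofReal_natCast]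
  refine ENNReal.ofReal_le_ofReal ?_
  rw [one_div, inv_mul_le_iff₀ hN0]
  simpa using sum_norm_conjTranspose_mul_le hU

/-! ### A finite minimax principle by separation -/

section Minimax

/-- A finite minimax principle for convex-like families of functions: if every convex combination of
the `φ · k` takes a value below `c`, then the `φ · k` are simultaneously below `c` somewhere. -/
theorem exists_forall_lt_of_forall_convexComb_lt {W ι : Type*} [Fintype ι] [Nonempty W]
    (φ : W → ι → ℝ) (c : ℝ)
    (hφ : ∀ w w' : W, ∀ a b : ℝ, 0 ≤ a → 0 ≤ b → a + b = 1 →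
      ∃ w'' : W, ∀ k, φ w'' k ≤ a * φ w k + b * φ w' k)
    (h : ∀ p : ι → ℝ, (∀ k, 0 ≤ p k) → ∑ k, p k = 1 → ∃ w, ∑ k, p k * φ w k < c) :
    ∃ w, ∀ k, φ w k < c := by
  classical
  by_contra! hcon
  let A : Set (ι → ℝ) := Set.univ.pi fun _ => Set.Iio c
  let C : Set (ι → ℝ) := {v | ∃ w, ∀ k, φ w k ≤ v k}
  have hAo : IsOpen A := isOpen_set_pi Set.finite_univ fun _ _ => isOpen_Iio
  have hAc : Convex ℝ A := convex_pi fun _ _ => convex_Iio c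
  have hCc : Convex ℝ C := by
    rintro v ⟨w, hw⟩ v' ⟨w', hw'⟩ a b ha hb hab
    obtain ⟨w'', hw''⟩ := hφ w w' a b ha hb hab
    refine ⟨w'', fun k => (hw'' k).trans ?_⟩
    exact add_le_add (mul_le_mul_of_nonneg_left (hw k) ha) (mul_le_mul_of_nonneg_left (hw' k) hb)
  have hdisj : Disjoint A C := by
    rw [Set.disjoint_left]
    rintro v hv ⟨w, hw⟩
    obtain ⟨k, hk⟩ := hcon w
    exact absurd (hv k (Set.mem_univ k)) (not_lt.2 (hk.trans (hw k)))
  obtain ⟨f, u, hfA, hfC⟩ := geometric_hahn_banach_open hAc hAo hCc hdisj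
  set p : ι → ℝ := fun k => f (Pi.single k 1) with hp
  have hf : ∀ v, f v = ∑ k, p k * v k := fun v => by
    conv_lhs => rw [pi_eq_sum_univ' v, map_sum]
    refine Finset.sum_congr rfl fun k _ => ?_
    rw [map_smul, smul_eq_mul, mul_comm]
  have hconst : ∀ t < c, (∑ k, p k) * t < u := fun t ht => by
    have := hfA (fun _ => t) fun _ _ => ht
    rwa [hf, ← Finset.sum_mul] at this
  -- `A` is unbounded below in each coordinate. Were `p k < 0`, lowering coordinate `k` by `t` would
  -- bring `f` up to exactly `u`, against `f < u` on `A`.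
  have hp0 : ∀ k, 0 ≤ p k := fun k => by
    by_contra! hk
    have h0 := hconst (c - 1) (by linarith)
    set t := (u - (∑ k, p k) * (c - 1)) / (-p k)
    have ht : 0 ≤ t := div_nonneg (by linarith) (by linarith)
    have hmem : (fun _ => c - 1) - t • (Pi.single k 1 : ι → ℝ) ∈ A := fun j _ => by
      have : 0 ≤ t * (Pi.single k 1 : ι → ℝ) j :=
        mul_nonneg ht (by rw [Pi.single_apply]; split_ifs <;> norm_num)
      simp only [Pi.sub_apply, Pi.smul_apply, smul_eq_mul, Set.mem_Iio]
      linarith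
    have h1 := hfA _ hmem
    rw [map_sub, map_smul, hf, ← Finset.sum_mul, smul_eq_mul] at h1
    have h2 : t * p k = -(u - (∑ k, p k) * (c - 1)) := by
      rw [div_mul_eq_mul_div, div_neg, mul_div_cancel_right₀ _ hk.ne]
    change _ - t * p k < u at h1
    linarith
  have hC : ∀ w, u ≤ ∑ k, p k * φ w k := fun w => by
    rw [← hf]; exact hfC _ ⟨w, fun _ => le_rfl⟩
  -- Zero total mass would give `f = 0` and `0 < u ≤ 0`; otherwise the weights normalize to a
  -- probability vector.
  obtain hσ | hσ := (Finset.sum_nonneg fun k _ => hp0 k : 0 ≤ ∑ k, p k).eq_or_lt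
  · have hz : ∀ k, p k = 0 := fun k =>
      (Finset.sum_eq_zero_iff_of_nonneg fun k _ => hp0 k).1 hσ.symm k (Finset.mem_univ k)
    have h1 := hconst (c - 1) (by linarith)
    have h2 := hC (Classical.arbitrary W)
    simp only [hz, zero_mul, Finset.sum_const_zero] at h1 h2
    linarith
  · set σ := ∑ k, p k with hσd
    obtain ⟨w, hw⟩ := h (fun k => p k / σ) (fun k => div_nonneg (hp0 k) hσ.le)
      (by rw [← Finset.sum_div, ← hσd, div_self hσ.ne'])
    have h1 : ∑ k, p k / σ * φ w k = (∑ k, p k * φ w k) / σ := by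
      rw [Finset.sum_div]
      exact Finset.sum_congr rfl fun k _ => by ring
    rw [h1] at hw
    have h2 := hconst _ hw
    rw [mul_div_cancel₀ _ hσ.ne'] at h2
    exact absurd (hC w) (not_le.2 h2)

end Minimax

/-! ### Almost norming functionals by compactness of the sphere -/

section Norming

/-- A finite-dimensional normed space is almost normed by finitely many functionals. -/
theorem exists_finset_dual_norming (𝕜 : Type) [RCLike 𝕜] (Y : Type*) [NormedAddCommGroup Y]
    [NormedSpace 𝕜 Y] [FiniteDimensional 𝕜 Y] {ε : ℝ} (hε : 0 < ε) :
    ∃ t : Finset (StrongDual 𝕜 Y), (∀ f ∈ t, ‖f‖ ≤ 1) ∧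
      ∀ y : Y, y ≠ 0 → ∃ f ∈ t, (1 - ε) * ‖y‖ ≤ ‖f y‖ := by
  classical
  have : ProperSpace Y := FiniteDimensional.proper 𝕜 Y
  have hcover : Metric.sphere (0 : Y) 1 ⊆
      ⋃ f : {f : StrongDual 𝕜 Y // ‖f‖ ≤ 1}, {y | 1 - ε < ‖f.1 y‖} := fun y hy => by
    rw [mem_sphere_zero_iff_norm] at hy
    obtain ⟨g, hg, hgy⟩ := exists_dual_vector'' 𝕜 y
    refine Set.mem_iUnion.2 ⟨⟨g, hg⟩, ?_⟩
    rw [Set.mem_ofPred_eq, hgy, hy]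
    simpa using hε
  obtain ⟨s, hs⟩ := (isCompact_sphere (0 : Y) 1).elim_finite_subcover _
    (fun f : {f : StrongDual 𝕜 Y // ‖f‖ ≤ 1} => isOpen_lt continuous_const f.1.continuous.norm)
    hcover
  refine ⟨s.image Subtype.val, fun f hf => ?_, fun y hy => ?_⟩
  · obtain ⟨g, -, rfl⟩ := Finset.mem_image.1 hf
    exact g.2
  · have hy0 : 0 < ‖y‖ := norm_pos_iff.2 hy
    have hmem : (((‖y‖⁻¹ : ℝ) : 𝕜) • y) ∈ Metric.sphere (0 : Y) 1 := by
      rw [mem_sphere_zero_iff_norm, norm_smul, RCLike.norm_ofReal, abs_of_pos (inv_pos.2 hy0),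
        inv_mul_cancel₀ hy0.ne']
    obtain ⟨f, hf⟩ := Set.mem_iUnion.1 (hs hmem)
    obtain ⟨hfs, hfy⟩ := Set.mem_iUnion.1 hf
    refine ⟨f.1, Finset.mem_image_of_mem _ hfs, ?_⟩
    rw [Set.mem_ofPred_eq, map_smul, norm_smul, RCLike.norm_ofReal, abs_of_pos (inv_pos.2 hy0),
      inv_mul_eq_div, lt_div_iff₀ hy0] at hfy
    exact hfy.le

end Norming

/-! ### Upper bound: reconstruction formulas and projections -/

section UpperBound

variable {𝕜 : Type} [RCLike 𝕜]

theorem sum_norm_le_card_mul_quasimax {m : ℕ} (hm : 1 ≤ m) {J : Type*} [Fintype J]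
    (hJ : m ≤ Fintype.card J) (U : Matrix (Fin m) J 𝕜) (hU : U * Uᴴ = 1) :
    ∑ i, ∑ j, ‖(Uᴴ * U) i j‖ ≤ Fintype.card J * (quasimaxAbsProjConst 𝕜 m).toReal := by
  let e := Fintype.equivFin J
  let V : Matrix (Fin m) (Fin (Fintype.card J)) 𝕜 := U.submatrix id e.symm
  have hV : V * Vᴴ = 1 := by
    rw [Matrix.conjTranspose_submatrix, Matrix.submatrix_mul_equiv, hU]
    exact Matrix.submatrix_id_id _
  have hsum : ∑ i, ∑ j, ‖(Uᴴ * U) i j‖ = ∑ i, ∑ j, ‖(Vᴴ * V) i j‖ := by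
    refine (Fintype.sum_equiv e.symm _ _ fun i => ?_).symm
    exact Fintype.sum_equiv e.symm _ _ fun j => rfl
  have hJ0 : (0 : ℝ) < Fintype.card J := by exact_mod_cast lt_of_lt_of_le hm hJ
  have hle : ENNReal.ofReal ((1 / (Fintype.card J : ℝ)) * ∑ i, ∑ j, ‖(Vᴴ * V) i j‖) ≤
      quasimaxAbsProjConst 𝕜 m := by
    unfold quasimaxAbsProjConst quasimaxRelProjConst
    exact le_iSup_of_le _ <| le_iSup_of_le hJ <| le_iSup_of_le V <| le_iSup_of_le hV le_rfl
  have hfin : quasimaxAbsProjConst 𝕜 m ≠ ∞ :=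
    ne_top_of_le_ne_top (ENNReal.natCast_ne_top m) (quasimaxAbsProjConst_le 𝕜 hm)
  have h := (ENNReal.ofReal_le_iff_le_toReal hfin).1 hle
  rwa [one_div, inv_mul_le_iff₀ hJ0, ← hsum] at h

variable {Y : Type*} [AddCommGroup Y] [Module 𝕜 Y] [FiniteDimensional 𝕜 Y]

/-- With `y k` the preimages of an orthonormal basis of the image of `Y`, put `v j = ∑ k, star (f j
(y k)) • y k`. Reconstruction is the orthonormal expansion, and `f a (v b)` is the entry `(Uᴴ * U) b
a` for `U k j = f j (y k)`. -/
theorem exists_reconstruction {m : ℕ} (hm : 1 ≤ m) (hY : Module.finrank 𝕜 Y = m)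
    {J : Type*} [Fintype J] (f : J → Y →ₗ[𝕜] 𝕜) (hf : ∀ y, (∀ j, f j y = 0) → y = 0) :
    ∃ v : J → Y, (∀ y, ∑ j, f j y • v j = y) ∧
      ∑ a, ∑ b, ‖f a (v b)‖ ≤ Fintype.card J * (quasimaxAbsProjConst 𝕜 m).toReal := by
  let T : Y →ₗ[𝕜] EuclideanSpace 𝕜 J :=
    (WithLp.linearEquiv 2 𝕜 (J → 𝕜)).symm.toLinearMap ∘ₗ LinearMap.pi f
  have hTj : ∀ y j, T y j = f j y := fun _ _ => rfl
  have hinj : Function.Injective T := by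
    rw [← LinearMap.ker_eq_bot, LinearMap.ker_eq_bot']
    intro y hy
    exact hf y fun j => by rw [← hTj, hy]; rfl
  have hrank : Module.finrank 𝕜 (LinearMap.range T) = m := by
    rw [LinearMap.finrank_range_of_inj hinj, hY]
  have hJ : m ≤ Fintype.card J := by
    rw [← hrank, ← finrank_euclideanSpace (𝕜 := 𝕜) (ι := J)]
    exact Submodule.finrank_le _
  let E := (stdOrthonormalBasis 𝕜 (LinearMap.range T)).reindex (finCongr hrank)
  choose y hy using fun k => (E k).2
  let U : Matrix (Fin m) J 𝕜 := fun k j => f j (y k)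
  have hinner : ∀ k z, ∑ j, star (f j (y k)) * f j z = inner 𝕜 (T (y k)) (T z) := fun k z => by
    rw [PiLp.inner_apply]
    refine Finset.sum_congr rfl fun j _ => ?_
    rw [RCLike.inner_apply, hTj, hTj, mul_comm]; rfl
  have hU : U * Uᴴ = 1 := by
    ext k l
    have h1 := orthonormal_iff_ite.1 E.orthonormal l k
    rw [Submodule.coe_inner, ← hy, ← hy, ← hinner] at h1
    rw [Matrix.mul_apply, Matrix.one_apply]
    simp only [U, mul_comm, eq_comm (a := k)] at h1 ⊢
    exact h1
  refine ⟨fun j => ∑ k, star (f j (y k)) • y k, fun z => hinj ?_, ?_⟩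
  · have h1 : ∑ j, f j z • ∑ k, star (f j (y k)) • y k =
        ∑ k, (inner 𝕜 (T (y k)) (T z) : 𝕜) • y k := by
      simp only [Finset.smul_sum, smul_smul]
      rw [Finset.sum_comm]
      refine Finset.sum_congr rfl fun k _ => ?_
      rw [← hinner, Finset.sum_smul]
      exact Finset.sum_congr rfl fun j _ => by rw [mul_comm]
    rw [h1, map_sum]
    have h2 := congrArg Subtype.val (E.sum_repr' ⟨T z, z, rfl⟩)
    rw [Submodule.coe_sum] at h2
    refine Eq.trans (Finset.sum_congr rfl fun k _ => ?_) h2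
    rw [map_smul, Submodule.coe_smul, Submodule.coe_inner, hy]
  · have h1 : ∀ a b, f a (∑ k, star (f b (y k)) • y k) = (Uᴴ * U) b a := fun a b => by
      rw [map_sum, Matrix.mul_apply]
      exact Finset.sum_congr rfl fun k _ => by rw [map_smul]; rfl
    simp only [h1]
    rw [Finset.sum_comm]
    exact sum_norm_le_card_mul_quasimax hm hJ U hU

/-- Functional `i` is repeated about `p i * K` times, so that uniform averaging over the copies
approximates the weights `p`; the vectors attached to its copies are then added up. Rounding adds at
most `card ι ≤ η K` copies. -/
theorem exists_weighted_reconstruction {m : ℕ} (hm : 1 ≤ m) (hY : Module.finrank 𝕜 Y = m)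
    {ι : Type*} [Fintype ι] (f : ι → Y →ₗ[𝕜] 𝕜) (hf : ∀ y, (∀ j, f j y = 0) → y = 0)
    {p : ι → ℝ} (hp0 : ∀ k, 0 ≤ p k) (hp1 : ∑ k, p k = 1) {η : ℝ} (hη : 0 < η) :
    ∃ w : ι → Y, (∀ y, ∑ j, f j y • w j = y) ∧
      ∑ k, p k * ∑ i, ‖f k (w i)‖ ≤ (1 + η) * (quasimaxAbsProjConst 𝕜 m).toReal := by
  obtain ⟨K, hK⟩ := exists_nat_gt ((Fintype.card ι : ℝ) / η)
  have hK0 : (0 : ℝ) < K := lt_of_le_of_lt (by positivity) hK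
  rw [div_lt_iff₀ hη] at hK
  -- The `+ 1` ensures `p i * K ≤ n i` and keeps every functional present even when `p i = 0`, so
  -- that the family still separates points.
  let n : ι → ℕ := fun i => ⌊p i * K⌋₊ + 1
  have hn : ∀ i, p i * K ≤ n i := fun i => by
    simp only [n]; push_cast; exact (Nat.lt_floor_add_one _).le
  obtain ⟨v, hv, hvs⟩ := exists_reconstruction hm hY (J := Σ i, Fin (n i)) (fun j => f j.1)
    fun y h => hf y fun i => h ⟨i, ⟨0, Nat.succ_pos _⟩⟩
  have hcard : (Fintype.card (Σ i, Fin (n i)) : ℝ) ≤ (1 + η) * K := by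
    rw [Fintype.card_sigma]
    push_cast
    calc ∑ i, (Fintype.card (Fin (n i)) : ℝ) ≤ ∑ i, (p i * K + 1) :=
          Finset.sum_le_sum fun i _ => by
            rw [Fintype.card_fin]
            simp only [n]; push_cast
            have := Nat.floor_le (mul_nonneg (hp0 i) hK0.le)
            linarith
      _ = K + Fintype.card ι := by
          rw [Finset.sum_add_distrib, ← Finset.sum_mul, hp1]; simp
      _ ≤ (1 + η) * K := by linarith
  set μ := (quasimaxAbsProjConst 𝕜 m).toReal
  have hμ : 0 ≤ μ := ENNReal.toReal_nonneg
  refine ⟨fun i => ∑ a, v ⟨i, a⟩, fun y => ?_, ?_⟩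
  · conv_rhs => rw [← hv y, Fintype.sum_sigma]
    exact Finset.sum_congr rfl fun i _ => Finset.smul_sum
  · have h1 : ∀ k, ∑ i, ‖f k (∑ a, v ⟨i, a⟩)‖ ≤ ∑ b, ‖f k (v b)‖ := fun k => by
      rw [Fintype.sum_sigma]
      refine Finset.sum_le_sum fun i _ => ?_
      rw [map_sum]
      exact norm_sum_le _ _
    have h2 : (∑ k, p k * ∑ i, ‖f k (∑ a, v ⟨i, a⟩)‖) * K ≤ (1 + η) * μ * K := by
      calc (∑ k, p k * ∑ i, ‖f k (∑ a, v ⟨i, a⟩)‖) * K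
          ≤ ∑ k, n k * ∑ b, ‖f k (v b)‖ := by
            rw [Finset.sum_mul]
            refine Finset.sum_le_sum fun k _ => ?_
            rw [mul_right_comm]
            exact mul_le_mul (hn k) (h1 k) (Finset.sum_nonneg fun _ _ => norm_nonneg _)
              (Nat.cast_nonneg _)
        _ = ∑ a : Σ i, Fin (n i), ∑ b, ‖f a.1 (v b)‖ := by
            rw [Fintype.sum_sigma]; simp
        _ ≤ _ := hvs
        _ ≤ (1 + η) * K * μ := by gcongr
        _ = _ := by ring
    exact le_of_mul_le_mul_right h2 hK0

/-- Reconstruction systems form an affine set on which each `∑ i, ‖f k (w i)‖` is convex, so the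
minimax principle applies. -/
theorem exists_uniform_reconstruction {m : ℕ} (hm : 1 ≤ m) (hY : Module.finrank 𝕜 Y = m)
    {ι : Type*} [Fintype ι] (f : ι → Y →ₗ[𝕜] 𝕜) (hf : ∀ y, (∀ j, f j y = 0) → y = 0)
    {c : ℝ} (hc : (quasimaxAbsProjConst 𝕜 m).toReal < c) :
    ∃ w : ι → Y, (∀ y, ∑ j, f j y • w j = y) ∧ ∀ k, ∑ i, ‖f k (w i)‖ < c := by
  set μ := (quasimaxAbsProjConst 𝕜 m).toReal with hμd
  have hμ : 0 ≤ μ := ENNReal.toReal_nonneg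
  -- For this `η`, `(1 + η) μ = c - η < c`; the denominator `μ + 1` avoids division by zero.
  have hη : 0 < (c - μ) / (μ + 1) := div_pos (by linarith) (by linarith)
  obtain ⟨v, hv, -⟩ := exists_reconstruction hm hY f hf
  have : Nonempty {w : ι → Y // ∀ y, ∑ j, f j y • w j = y} := ⟨⟨v, hv⟩⟩
  refine (exists_forall_lt_of_forall_convexComb_lt
    (fun (w : {w : ι → Y // ∀ y, ∑ j, f j y • w j = y}) k => ∑ i, ‖f k (w.1 i)‖) c ?_ ?_).elim
    fun w hw => ⟨w.1, w.2, hw⟩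
  · intro w w' a b ha hb hab
    refine ⟨⟨fun i => (a : 𝕜) • w.1 i + (b : 𝕜) • w'.1 i, fun y => ?_⟩, fun k => ?_⟩
    · simp only [smul_add, Finset.sum_add_distrib]
      simp only [smul_comm (f _ y), ← Finset.smul_sum]
      rw [w.2, w'.2, ← add_smul, ← RCLike.ofReal_add, hab, RCLike.ofReal_one, one_smul]
    · simp only
      rw [Finset.mul_sum, Finset.mul_sum, ← Finset.sum_add_distrib]
      refine Finset.sum_le_sum fun i _ => ?_
      rw [map_add, map_smul, map_smul]
      refine (norm_add_le _ _).trans_eq ?_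
      rw [norm_smul, norm_smul, RCLike.norm_ofReal, RCLike.norm_ofReal, abs_of_nonneg ha,
        abs_of_nonneg hb]
  · intro p hp0 hp1
    obtain ⟨w, hw, hws⟩ := exists_weighted_reconstruction hm hY f hf hp0 hp1 hη
    refine ⟨⟨w, hw⟩, hws.trans_lt ?_⟩
    have h1 : (c - μ) / (μ + 1) * (μ + 1) = c - μ := div_mul_cancel₀ _ (by linarith)
    rw [← hμd]
    linarith

theorem relProjConst_le_quasimax {m : ℕ} (hm : 1 ≤ m) {X : Type*} [NormedAddCommGroup X]
    [NormedSpace 𝕜 X] (Z : Submodule 𝕜 X) (hZ : Module.finrank 𝕜 Z = m) :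
    relProjConst 𝕜 X Z ≤ quasimaxAbsProjConst 𝕜 m := by
  have hfinZ : FiniteDimensional 𝕜 Z := Module.finite_of_finrank_pos (by omega)
  have hfin : quasimaxAbsProjConst 𝕜 m ≠ ∞ :=
    ne_top_of_le_ne_top (ENNReal.natCast_ne_top m) (quasimaxAbsProjConst_le 𝕜 hm)
  refine le_of_forall_gt_imp_ge_of_dense fun a ha => ?_
  obtain rfl | hatop := eq_or_ne a ∞
  · exact le_top
  have hlt := (ENNReal.toReal_lt_toReal hfin hatop).2 ha
  set μ := (quasimaxAbsProjConst 𝕜 m).toReal with hμd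
  set C := a.toReal with hC
  have hμ : 0 ≤ μ := ENNReal.toReal_nonneg
  have hC0 : 0 < C := by linarith
  -- The gap between `μ` and `C` is split at its midpoint: the reconstruction sums stay below `(C +
  -- μ) / 2`, and this `ε` is chosen so that dividing by the norming factor `1 - ε` gives exactly
  -- `C`.
  obtain ⟨t, ht1, ht⟩ := exists_finset_dual_norming 𝕜 Z
    (ε := (C - μ) / (2 * C)) (div_pos (by linarith) (by linarith))
  have hθ : (1 - (C - μ) / (2 * C)) * C = (C + μ) / 2 := by field_simp; ring
  set θ := 1 - (C - μ) / (2 * C) with hθd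
  have hθ0 : 0 < θ := by
    by_contra! h0
    have := mul_nonpos_of_nonpos_of_nonneg h0 hC0.le
    linarith
  obtain ⟨w, hw, hws⟩ := exists_uniform_reconstruction hm hZ (fun f : t => f.1.toLinearMap)
    (fun y h => by
      by_contra hy
      obtain ⟨f, hft, hfy⟩ := ht y hy
      have h0 : f y = 0 := h ⟨f, hft⟩
      rw [h0, norm_zero] at hfy
      exact absurd hfy (not_le.2 (mul_pos hθ0 (norm_pos_iff.2 hy))))
    (c := (C + μ) / 2) (by linarith)
  choose F hF hFn using fun f : t => exists_extension_norm_eq Z f.1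
  let P : X →L[𝕜] Z := ∑ f : t, (F f).smulRight (w f)
  have hPx : ∀ x, P x = ∑ f : t, F f x • w f := fun x => by
    simp [P]
  have hP : ∀ y : Z, P (y : X) = y := fun y => by
    rw [hPx]
    simp only [hF]
    exact hw y
  have hPn : ‖P‖ ≤ C := by
    refine P.opNorm_le_bound hC0.le fun x => ?_
    obtain h0 | h0 := eq_or_ne (P x) 0
    · rw [h0, norm_zero]; positivity
    obtain ⟨g, hgt, hg⟩ := ht _ h0
    have h1 : ‖g (P x)‖ ≤ ‖x‖ * ∑ f : t, ‖g (w f)‖ := by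
      rw [hPx, map_sum, Finset.mul_sum]
      refine (norm_sum_le _ _).trans (Finset.sum_le_sum fun f _ => ?_)
      rw [map_smul, norm_smul]
      gcongr
      refine ((F f).le_opNorm x).trans ?_
      rw [hFn]
      exact mul_le_of_le_one_left (norm_nonneg _) (ht1 _ f.2)
    have h2 : ∑ f : t, ‖g (w f)‖ ≤ (C + μ) / 2 := (hws ⟨g, hgt⟩).le
    have h3 : θ * ‖P x‖ ≤ θ * (C * ‖x‖) := by
      calc θ * ‖P x‖ ≤ ‖x‖ * ((C + μ) / 2) :=
            hg.trans (h1.trans (mul_le_mul_of_nonneg_left h2 (norm_nonneg _)))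
        _ = _ := by rw [← hθ]; ring
    exact le_of_mul_le_mul_left h3 hθ0
  refine (iInf₂_le P hP).trans ?_
  rw [← ofReal_norm, ← ENNReal.ofReal_toReal hatop]
  exact ENNReal.ofReal_le_ofReal hPn

end UpperBound

theorem maxAbsProjConst_le_quasimaxAbsProjConst (𝕜 : Type) [RCLike 𝕜] {m : ℕ} (hm : 1 ≤ m) :
    maxAbsProjConst.{u} 𝕜 m ≤ quasimaxAbsProjConst 𝕜 m := by
  refine iSup_le fun Y => iSup_le fun _ => iSup_le fun _ => iSup_le fun _ => iSup_le fun hY => ?_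
  refine iSup_le fun X => iSup_le fun _ => iSup_le fun _ => iSup_le fun _ => iSup_le fun e => ?_
  exact relProjConst_le_quasimax hm _
    ((LinearMap.finrank_range_of_inj e.injective).trans hY)

theorem theorem4 (𝕜 : Type) [RCLike 𝕜] (m : ℕ) (hm : 1 ≤ m) :
    maxAbsProjConst.{u} 𝕜 m = quasimaxAbsProjConst 𝕜 m ∧ maxAbsProjConst.{u} 𝕜 m ≠ ∞ := by
  have h := maxAbsProjConst_le_quasimaxAbsProjConst.{u} 𝕜 hm
  refine ⟨h.antisymm (quasimaxAbsProjConst_le_maxAbsProjConst 𝕜 hm), ?_⟩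
  exact ne_top_of_le_ne_top (ENNReal.natCast_ne_top m) (h.trans (quasimaxAbsProjConst_le 𝕜 hm))
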